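/- For a finite group $G$, let $\mathcal{U}(\mathbb{Z}[G])$ denote the group of units of the integral group ring $\mathbb{Z}[G]$. Say that $G$ has the cut-property if all central units of $\mathbb{Z}[G]$ are trivial, that is, if every element of the centre of $\mathcal{U}(\mathbb{Z}[G])$ is of the form $g$ or $-g$ with $g$ in the centre of $G$. If $H$ and $K$ are finite $3$-groups with the cut-property, then the direct product $H\times K$ also has the cut-property. -/

import Mathlib

/-- A group `G` has the cut-property if all central units of the integral group ring `ℤ[G]` are
trivial: every element of the centre of the unit group of `ℤ[G]` is of the form `g` or `-g`
with `g` in the centre of `G`. -/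
def HasCutProperty (G : Type*) [Group G] : Prop :=
  ∀ u : (MonoidAlgebra ℤ G)ˣ, u ∈ Subgroup.center (MonoidAlgebra ℤ G)ˣ →
    ∃ g ∈ Subgroup.center G,
      (u : MonoidAlgebra ℤ G) = MonoidAlgebra.of ℤ G g ∨
      (u : MonoidAlgebra ℤ G) = -MonoidAlgebra.of ℤ G g

/-!
The cut-property of a finite `3`-group is equivalent to a condition on conjugacy: `g ^ j` is
conjugate to `g` for all `g` and all `j ≡ 1` modulo `3`. This condition passes to direct products
componentwise, which gives the theorem. (For a general finite group, the property corresponds to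
`g ^ j` being conjugate to `g` or to `g⁻¹` for `j` coprime to the order, and the choice of sign need
not be the same in both factors of a product; for `3`-groups it depends only on `j` modulo `3`.)

Both directions go through the central characters, the homomorphisms from the centre of `ℚ[G]` to
an algebraic closure of `ℚ` that give the action of the centre on matrix representations. They
separate points (`eq_zero_of_forall_isCentralCharacter`), and an automorphism raising roots of unity
to the `j`-th power acts on them through `g ↦ g ^ j` (`IsCentralCharacter.map_eq_map`).

If `G` has the cut-property, then the values of a central character form a number field all of whose
integral units have finite order, since a power of such a unit lifts to a central unit of `ℤ[G]`.
By Dirichlet's unit theorem the field has only one infinite place, so that a Galois automorphism acts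
on the values trivially or as complex conjugation (`HasCutProperty.eq_or_eq_conj`). Comparing class
sums, `g ^ j` is conjugate to `g` or to `g⁻¹` (`HasCutProperty.isConj_pow_or`), and in a `3`-group
the second case is excluded for `j ≡ 1` modulo `3`, unless `g = 1`.

Conversely, under the conjugacy condition a symmetric central unit of `ℤ[G]` takes rational, hence
`1` or `-1`, values under all central characters. Applied to `u * u^*` for a central unit `u`, this
yields `u * u^* = 1`, that is `∑ g, u g ^ 2 = 1` (`hasCutProperty_of_forall_isConj_pow`).
-/

open scoped MonoidAlgebra

/-! ### Traces of endomorphisms of finite order -/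

/-- If `f ^ n = 1` and `σ`, `τ` are field embeddings with `σ ζ = τ (ζ ^ j)` on `n`-th roots of unity,
then `σ (tr f) = τ (tr (f ^ j))`: the endomorphism is diagonalizable, and its eigenvalues are
`n`-th roots of unity. -/
theorem Module.End.trace_pow_of_pow_eq_one {F L V : Type*} [Field F] [IsAlgClosed F] [CharZero F]
    [Field L] [AddCommGroup V] [Module F V] [FiniteDimensional F V]
    (f : Module.End F V) {n : ℕ} (hn : n ≠ 0) (hf : f ^ n = 1) (σ τ : F →+* L) (j : ℕ)
    (h : ∀ ζ : F, ζ ^ n = 1 → σ ζ = τ (ζ ^ j)) :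
    σ (LinearMap.trace F V f) = τ (LinearMap.trace F V (f ^ j)) := by
  classical
  have hss : f.IsFinitelySemisimple := by
    refine (Module.End.isSemisimple_of_squarefree_aeval_eq_zero
      (p := (Polynomial.X ^ n - 1 : Polynomial F)) ?_ ?_).isFinitelySemisimple
    · exact (Polynomial.X_pow_sub_one_separable_iff.2 (Nat.cast_ne_zero.2 hn)).squarefree
    · simp [hf]
  have htop : ⨆ μ, f.eigenspace μ = ⊤ := by
    rw [← Module.End.iSup_maxGenEigenspace_eq_top f]
    exact iSup_congr fun μ ↦ (hss.maxGenEigenspace_eq_eigenspace μ).symm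
  have hint : DirectSum.IsInternal f.eigenspace :=
    DirectSum.isInternal_submodule_of_iSupIndep_of_iSup_eq_top f.eigenspaces_iSupIndep htop
  have hfin : {μ | f.eigenspace μ ≠ ⊥}.Finite :=
    WellFoundedGT.finite_ne_bot_of_iSupIndep f.eigenspaces_iSupIndep
  have hpow (k : ℕ) (μ : F) (x : V) (hx : x ∈ f.eigenspace μ) : (f ^ k) x = μ ^ k • x := by
    induction k with
    | zero => simp
    | succ k ih => rw [pow_succ', Module.End.mul_apply, ih, map_smul,
        Module.End.mem_eigenspace_iff.1 hx, smul_smul, pow_succ]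
  have htr (k : ℕ) : LinearMap.trace F V (f ^ k) =
      ∑ μ ∈ hfin.toFinset, μ ^ k * (Module.finrank F (f.eigenspace μ) : F) := by
    have hmaps (μ : F) : Set.MapsTo (f ^ k) (f.eigenspace μ) (f.eigenspace μ) := fun x hx ↦ by
      rw [hpow k μ x hx]
      exact Submodule.smul_mem _ _ hx
    rw [LinearMap.trace_eq_sum_trace_restrict' hint hfin hmaps]
    refine Finset.sum_congr rfl fun μ _ ↦ ?_
    have : (f ^ k).restrict (hmaps μ) = μ ^ k • LinearMap.id := by
      ext x
      exact hpow k μ x x.2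
    rw [this, map_smul, LinearMap.trace_id, smul_eq_mul]
  have h1 := htr 1
  rw [pow_one] at h1
  rw [h1, htr j, map_sum, map_sum]
  refine Finset.sum_congr rfl fun μ hμ ↦ ?_
  obtain ⟨x, hx, hx0⟩ := Submodule.exists_mem_ne_zero_of_ne_bot (hfin.mem_toFinset.1 hμ)
  have hμn : μ ^ n = 1 := by
    have := hpow n μ x hx
    rw [hf, Module.End.one_apply] at this
    exact smul_left_injective F hx0 (by simpa using this.symm)
  rw [map_mul, map_mul, map_natCast, map_natCast, pow_one, h μ hμn]

theorem Matrix.trace_pow_of_pow_eq_one {F L ι : Type*} [Field F] [IsAlgClosed F] [CharZero F]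
    [Field L] [Fintype ι] [DecidableEq ι]
    (M : Matrix ι ι F) {n : ℕ} (hn : n ≠ 0) (hM : M ^ n = 1) (σ τ : F →+* L) (j : ℕ)
    (h : ∀ ζ : F, ζ ^ n = 1 → σ ζ = τ (ζ ^ j)) :
    σ M.trace = τ (M ^ j).trace := by
  have := Module.End.trace_pow_of_pow_eq_one (Matrix.toLin' M) hn
    (by rw [← Matrix.toLin'_pow, hM, Matrix.toLin'_one]; rfl) σ τ j h
  rwa [← Matrix.toLin'_pow, Matrix.trace_toLin'_eq, Matrix.trace_toLin'_eq] at this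

/-! ### Galois action on roots of unity -/

/-- Irreducibility of the cyclotomic polynomials: every `j` coprime to `n` is realized by an
automorphism acting on `n`-th roots of unity as the `j`-th power. -/
theorem IsAlgClosure.exists_algEquiv_pow (F : Type*) [Field F] [CharZero F]
    [IsAlgClosure ℚ F] {n j : ℕ} (hn : n ≠ 0) (hj : j.Coprime n) :
    ∃ σ : F ≃ₐ[ℚ] F,
      ∀ ζ : F, ζ ^ n = 1 → σ ζ = ζ ^ j := by
  have : NeZero n := ⟨hn⟩
  have : IsAlgClosed F := IsAlgClosure.isAlgClosed ℚ
  obtain ⟨ζ, hζ⟩ := HasEnoughRootsOfUnity.exists_primitiveRoot F n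
  have : Normal ℚ F := IsAlgClosure.normal ℚ F
  have hconj : IsConjRoot ℚ (ζ ^ j) ζ := by
    rw [IsConjRoot, ← Polynomial.cyclotomic_eq_minpoly_rat hζ hn.bot_lt,
      ← Polynomial.cyclotomic_eq_minpoly_rat (hζ.pow_of_coprime j hj) hn.bot_lt]
  obtain ⟨σ, hσ⟩ := isConjRoot_iff_exists_algEquiv.1 hconj
  refine ⟨σ, fun ξ hξ ↦ ?_⟩
  obtain ⟨i, -, rfl⟩ := hζ.eq_pow_of_pow_eq_one hξ
  rw [map_pow, hσ, pow_right_comm]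

theorem IsAlgClosure.exists_pow_of_algEquiv {F : Type*} [Field F] [CharZero F]
    [IsAlgClosure ℚ F] {n : ℕ} (hn : n ≠ 0)
    (σ : F ≃ₐ[ℚ] F) :
    ∃ j : ℕ, j.Coprime n ∧ ∀ ζ : F, ζ ^ n = 1 → σ ζ = ζ ^ j := by
  have : NeZero n := ⟨hn⟩
  have : IsAlgClosed F := IsAlgClosure.isAlgClosed ℚ
  obtain ⟨ζ, hζ⟩ := HasEnoughRootsOfUnity.exists_primitiveRoot F n
  have hσ : IsPrimitiveRoot (σ ζ) n := hζ.map_of_injective σ.injective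
  obtain ⟨j, -, hj, hj'⟩ := (hζ.isPrimitiveRoot_iff).1 hσ
  refine ⟨j, hj, fun ξ hξ ↦ ?_⟩
  obtain ⟨i, -, rfl⟩ := hζ.eq_pow_of_pow_eq_one hξ
  rw [map_pow, ← hj', pow_right_comm]

/-- The `ℚ`-algebra structure here is the one every field of characteristic zero carries; it agrees
with that of `AlgebraicClosure ℚ` only propositionally. -/
theorem isAlgClosure_algebraicClosure_rat : IsAlgClosure ℚ (AlgebraicClosure ℚ) where
  isAlgClosed := inferInstance
  isAlgebraic := by
    convert AlgebraicClosure.isAlgebraic ℚ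
    · rfl
    · exact Subsingleton.elim _ _

/-! ### Central characters -/

/-- A central character of `G` over `F`: the homomorphism `φ` from the centre of `ℚ[G]` to `F`
through which the centre acts, by scalars, in some nonzero matrix representation `ρ` of `G`.
Irreducibility of `ρ` is not required. -/
def IsCentralCharacter {G F : Type*} [Group G] [Field F] [CharZero F]
    (φ : Subalgebra.center ℚ ℚ[G] →ₐ[ℚ] F) : Prop :=
  ∃ d : ℕ, d ≠ 0 ∧ ∃ ρ : G →* Matrix (Fin d) (Fin d) F, ∀ z : Subalgebra.center ℚ ℚ[G],
    MonoidAlgebra.lift ℚ (Matrix (Fin d) (Fin d) F) G ρ z =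
      algebraMap F (Matrix (Fin d) (Fin d) F) (φ z)

/-- The central characters separate the points of the centre of `ℚ[G]`. By Maschke and
Wedderburn–Artin `F[G]` is a product of matrix algebras over `F`, in each of which central elements
are scalar. -/
theorem eq_zero_of_forall_isCentralCharacter {G : Type*} [Group G] [Finite G] (F : Type*)
    [Field F] [CharZero F] [IsAlgClosed F] {z : Subalgebra.center ℚ ℚ[G]}
    (hz : ∀ φ : Subalgebra.center ℚ ℚ[G] →ₐ[ℚ] F, IsCentralCharacter φ → φ z = 0) :
    z = 0 := by
  have : NeZero (Nat.card G : F) := ⟨Nat.cast_ne_zero.2 Nat.card_pos.ne'⟩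
  have : FiniteDimensional F F[G] := inferInstance
  obtain ⟨n, d, hd, ⟨e⟩⟩ :=
    IsSemisimpleRing.exists_algEquiv_pi_matrix_of_isAlgClosed F F[G]
  let ι : ℚ[G] →ₐ[ℚ] F[G] := MonoidAlgebra.mapAlgHom G (Algebra.ofId ℚ F)
  have hι : Function.Injective ι := by
    intro x y hxy
    ext g
    have := congrArg (fun w ↦ w.coeff g) hxy
    simpa [ι] using this
  let ρ (i : Fin n) : G →* Matrix (Fin (d i)) (Fin (d i)) F :=
    (MonoidAlgebra.lift F _ G).symm
      ((Pi.evalAlgHom F (fun i ↦ Matrix (Fin (d i)) (Fin (d i)) F) i).comp (e : F[G] →ₐ[F] _))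
  have hρ (i : Fin n) (x : ℚ[G]) :
      MonoidAlgebra.lift ℚ (Matrix (Fin (d i)) (Fin (d i)) F) G (ρ i) x = e (ι x) i := by
    have : MonoidAlgebra.lift ℚ (Matrix (Fin (d i)) (Fin (d i)) F) G (ρ i) =
        ((Pi.evalAlgHom ℚ (fun i ↦ Matrix (Fin (d i)) (Fin (d i)) F) i).comp
          ((e : F[G] →ₐ[F] _).restrictScalars ℚ)).comp ι := by
      ext g : 2
      simp [ρ, ι]
    rw [this]
    rfl
  have hcomm (x : Subalgebra.center ℚ ℚ[G]) (y : F[G]) : Commute (ι x) y := by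
    induction y using MonoidAlgebra.induction_linear with
    | zero => exact Commute.zero_right _
    | add y y' h h' => exact h.add_right h'
    | single g r =>
      have h1 : Commute (ι x) (ι (MonoidAlgebra.single g 1)) :=
        .map (((Subalgebra.mem_center_iff.1 x.2) _).symm) ι
      have h2 : MonoidAlgebra.single g r = r • ι (MonoidAlgebra.single g 1) := by
        simp [ι, MonoidAlgebra.smul_single]
      rw [h2]
      exact h1.smul_right r
  have hscalar (i : Fin n) (x : Subalgebra.center ℚ ℚ[G]) :
      e (ι x) i ∈ Set.range (algebraMap F (Matrix (Fin (d i)) (Fin (d i)) F)) := by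
    have : e (ι x) i ∈ Subalgebra.center F (Matrix (Fin (d i)) (Fin (d i)) F) := by
      rw [Subalgebra.mem_center_iff]
      intro M
      obtain ⟨y, hy⟩ := e.surjective (Pi.single i M)
      have := congrFun (congrArg e (hcomm x y).eq) i
      simpa [hy] using this.symm
    have h2 : e (ι x) i ∈ Set.center (Matrix (Fin (d i)) (Fin (d i)) F) := this
    rw [Matrix.center_eq_range] at h2
    exact h2
  have hzero (i : Fin n) : e (ι z) i = 0 := by
    have := hd i
    let g : F →ₐ[ℚ] Matrix (Fin (d i)) (Fin (d i)) F :=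
      (Algebra.ofId F (Matrix (Fin (d i)) (Fin (d i)) F)).restrictScalars ℚ
    have hg : Function.Injective g := (algebraMap F (Matrix (Fin (d i)) (Fin (d i)) F)).injective
    let f : Subalgebra.center ℚ ℚ[G] →ₐ[ℚ] Matrix (Fin (d i)) (Fin (d i)) F :=
      (MonoidAlgebra.lift ℚ (Matrix (Fin (d i)) (Fin (d i)) F) G (ρ i)).comp (Subalgebra.val _)
    have hf (x) : f x ∈ g.range := by
      obtain ⟨r, hr⟩ := hscalar i x
      exact ⟨r, hr.trans (hρ i x).symm⟩
    let φ : Subalgebra.center ℚ ℚ[G] →ₐ[ℚ] F :=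
      ((AlgEquiv.ofInjective g hg).symm : g.range →ₐ[ℚ] F).comp (f.codRestrict g.range hf)
    have hφ (x) : f x = g (φ x) :=
      congrArg Subtype.val ((AlgEquiv.ofInjective g hg).apply_symm_apply ⟨f x, hf x⟩).symm
    have h0 := hz φ ⟨d i, NeZero.ne _, ρ i, hφ⟩
    rw [← hρ]
    refine (hφ z).trans ?_
    rw [h0, map_zero]
  have : e (ι z) = 0 := funext hzero
  have : ι z = 0 := by simpa using this
  exact Subtype.ext (hι (this.trans (map_zero ι).symm))

/-- The Galois action on central characters. Taking traces in the defining identity of a central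
character gives `d * φ z = ∑ g, z g * tr (ρ g)`, and `σ` turns `tr (ρ g)` into `τ (tr (ρ (g ^ j)))`.
The hypothesis on `z'` says that `z'` is `z` transported along `g ↦ g ^ j`, as seen by class
functions. -/
theorem IsCentralCharacter.map_eq_map {G F L : Type*} [Group G] [Fintype G] [Field F] [CharZero F]
    [IsAlgClosed F] [Field L] [CharZero L] {φ : Subalgebra.center ℚ ℚ[G] →ₐ[ℚ] F}
    (hφ : IsCentralCharacter φ) (σ τ : F →+* L) (j : ℕ)
    (h : ∀ ζ : F, ζ ^ Nat.card G = 1 → σ ζ = τ (ζ ^ j)) (z z' : Subalgebra.center ℚ ℚ[G])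
    (hz : ∀ f : G → L, (∀ x y, f (x * y * x⁻¹) = f y) →
      ∑ g, ((z : ℚ[G]).coeff g : L) * f (g ^ j) = ∑ g, ((z' : ℚ[G]).coeff g : L) * f g) :
    σ (φ z) = τ (φ z') := by
  obtain ⟨d, hd, ρ, hρ⟩ := hφ
  have key (w : Subalgebra.center ℚ ℚ[G]) :
      (d : F) * φ w = ∑ g, ((w : ℚ[G]).coeff g : F) * (ρ g).trace := by
    have := congrArg Matrix.trace (hρ w)
    rw [MonoidAlgebra.lift_apply, Finsupp.sum_fintype _ _ (by simp), Matrix.trace_sum,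
      Algebra.algebraMap_eq_smul_one, Matrix.trace_smul, Matrix.trace_one, Fintype.card_fin,
      smul_eq_mul, mul_comm] at this
    rw [← this]
    exact Finset.sum_congr rfl fun g _ ↦ by rw [Matrix.trace_smul, Rat.smul_def]
  have hdL : (d : L) ≠ 0 := Nat.cast_ne_zero.2 hd
  apply mul_left_cancel₀ hdL
  rw [← map_natCast σ d, ← map_mul, key, map_natCast σ d, ← map_natCast τ d, ← map_mul, key,
    map_sum, map_sum]
  have htr (g : G) : σ (ρ g).trace = τ (ρ (g ^ j)).trace := by
    rw [map_pow]
    refine Matrix.trace_pow_of_pow_eq_one _ Nat.card_pos.ne' ?_ σ τ j h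
    rw [← map_pow, pow_card_eq_one', map_one]
  simp only [map_mul, map_ratCast, htr]
  refine hz (fun g ↦ τ (ρ g).trace) fun x y ↦ ?_
  rw [map_mul, map_mul, Matrix.trace_mul_cycle, ← map_mul, ← map_mul, inv_mul_cancel, one_mul]

/-! ### Lifting units of number fields to the integral group ring -/

/-- If every element of `A` has a nonzero multiple in `R`, then a common power of an integral unit
and of its integral inverse lies in `R`. With `N` a common denominator of the finite `ℤ`-algebra
`S = ℤ[a, b]`, so that `N S ⊆ R`, the power is chosen to be `1` in the finite ring `S / N S`. -/
theorem exists_pow_mem_of_isIntegral {A : Type*} [CommRing A] (R : Subring A)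
    (hR : ∀ x : A, ∃ m : ℕ, m ≠ 0 ∧ m • x ∈ R) {a b : A} (hab : a * b = 1)
    (ha : IsIntegral ℤ a) (hb : IsIntegral ℤ b) :
    ∃ t : ℕ, t ≠ 0 ∧ a ^ t ∈ R ∧ b ^ t ∈ R := by
  classical
  let S : Subalgebra ℤ A := Algebra.adjoin ℤ {a, b}
  have hfin : Module.Finite ℤ S := Algebra.finite_adjoin_of_finite_of_isIntegral
    (Set.toFinite _) (by simp [ha, hb])
  obtain ⟨s, hs⟩ := hfin.fg_top
  choose m hm0 hm using hR
  let N : ℕ := ∏ x ∈ s, m x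
  have hN0 : N ≠ 0 := Finset.prod_ne_zero_iff.2 fun x _ ↦ hm0 x
  have hNS (x : S) : N • (x : A) ∈ R := by
    have hx : x ∈ Submodule.span ℤ (s : Set S) := hs ▸ Submodule.mem_top
    induction hx using Submodule.span_induction with
    | mem x hx =>
      obtain ⟨k, hk⟩ := Finset.dvd_prod_of_mem (fun x : S ↦ m x) (Finset.mem_coe.1 hx)
      rw [show N = k * m x by rw [mul_comm]; exact hk, mul_smul]
      exact nsmul_mem (hm x) k
    | zero => simp
    | add x y _ _ hx hy =>
      rw [Subalgebra.coe_add, smul_add]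
      exact add_mem hx hy
    | smul k x _ hx =>
      rw [Subalgebra.coe_smul, smul_comm]
      exact zsmul_mem hx k
  let I : Ideal S := Ideal.span {(N : S)}
  have : Finite (S ⧸ I) := by
    have : AddGroup.FG (S ⧸ I) := Module.Finite.iff_addGroup_fg.1 inferInstance
    refine AddCommGroup.finite_of_fg_isAddTorsion _ fun x ↦ ?_
    rw [isOfFinAddOrder_iff_nsmul_eq_zero]
    refine ⟨N, hN0.bot_lt, ?_⟩
    obtain ⟨x, rfl⟩ := Ideal.Quotient.mk_surjective x
    rw [← map_nsmul, Ideal.Quotient.eq_zero_iff_mem, nsmul_eq_mul]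
    exact Ideal.mul_mem_right _ _ (Ideal.mem_span_singleton_self _)
  let a' : S := ⟨a, Algebra.subset_adjoin (by simp)⟩
  let b' : S := ⟨b, Algebra.subset_adjoin (by simp)⟩
  have hab' : a' * b' = 1 := Subtype.ext hab
  let u : (S ⧸ I)ˣ := Units.mkOfMulEqOne (Ideal.Quotient.mk I a') (Ideal.Quotient.mk I b')
    (by rw [← map_mul, hab', map_one])
  obtain ⟨t, ht, hut⟩ := isOfFinOrder_iff_pow_eq_one.1 (isOfFinOrder_of_finite u)
  have key (c : S) (hc : Ideal.Quotient.mk I c ^ t = 1) : (c : A) ^ t ∈ R := by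
    rw [← map_pow, ← map_one (Ideal.Quotient.mk I), Ideal.Quotient.mk_eq_mk_iff_sub_mem,
      Ideal.mem_span_singleton] at hc
    obtain ⟨d, hd⟩ := hc
    have : (c : A) ^ t = 1 + N • (d : A) := by
      have := congrArg (Subtype.val) (sub_eq_iff_eq_add'.1 hd)
      simpa [nsmul_eq_mul] using this
    rw [this]
    exact add_mem (one_mem _) (hNS d)
  refine ⟨t, ht.ne', key a' ?_, key b' ?_⟩
  · exact congrArg Units.val hut
  · have : u⁻¹ ^ t = 1 := by rw [inv_pow, hut, inv_one]
    exact congrArg Units.val this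

instance isReduced_center_monoidAlgebra {G : Type*} [Group G] [Finite G] :
    IsReduced (Subalgebra.center ℚ ℚ[G]) where
  eq_zero x := fun ⟨n, hx⟩ ↦ eq_zero_of_forall_isCentralCharacter ℂ fun φ _ ↦
    eq_zero_of_pow_eq_zero (n := n) (by rw [← map_pow, hx, map_zero])

theorem MonoidAlgebra.mapRingHom_intCast_injective (G : Type*) [Group G] :
    Function.Injective (MonoidAlgebra.mapRingHom G (Int.castRingHom ℚ)) := by
  rw [MonoidAlgebra.coe_mapRingHom]
  exact MonoidAlgebra.map_injective _ Int.cast_injective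

theorem MonoidAlgebra.exists_nsmul_mem_range_mapRingHom {G : Type*} [Group G] [Finite G]
    (x : ℚ[G]) : ∃ m : ℕ, m ≠ 0 ∧
      m • x ∈ (MonoidAlgebra.mapRingHom G (Int.castRingHom ℚ)).range := by
  induction x using MonoidAlgebra.induction_linear with
  | zero => exact ⟨1, one_ne_zero, by simp⟩
  | add x y hx hy =>
    obtain ⟨m, hm, hx⟩ := hx
    obtain ⟨k, hk, hy⟩ := hy
    refine ⟨m * k, mul_ne_zero hm hk, ?_⟩
    rw [smul_add, mul_comm, mul_smul, mul_comm, mul_smul]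
    exact add_mem (nsmul_mem hx k) (nsmul_mem hy m)
  | single g q =>
    refine ⟨q.den, q.den_nz, MonoidAlgebra.single g q.num, ?_⟩
    rw [MonoidAlgebra.mapRingHom_single, MonoidAlgebra.smul_single, nsmul_eq_mul,
      Rat.den_mul_eq_num]
    rfl

/-- If `G` has the cut-property, then integral units of the centre of `ℚ[G]` have finite order,
although they need not lie in `ℤ[G]`: some power does. -/
theorem HasCutProperty.exists_pow_eq_one {G : Type*} [Group G] [Finite G] (hG : HasCutProperty G)
    {a b : Subalgebra.center ℚ ℚ[G]} (hab : a * b = 1) (ha : IsIntegral ℤ a)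
    (hb : IsIntegral ℤ b) : ∃ t : ℕ, t ≠ 0 ∧ a ^ t = 1 := by
  let f := MonoidAlgebra.mapRingHom G (Int.castRingHom ℚ)
  have hf : Function.Injective f := MonoidAlgebra.mapRingHom_intCast_injective G
  obtain ⟨t, ht, ⟨x, hx⟩, ⟨y, hy⟩⟩ := exists_pow_mem_of_isIntegral
    (f.range.comap (Subalgebra.center ℚ ℚ[G]).val.toRingHom)
    (fun x ↦ MonoidAlgebra.exists_nsmul_mem_range_mapRingHom (x : ℚ[G])) hab ha hb
  have hx' : f x = ((a ^ t : Subalgebra.center ℚ ℚ[G]) : ℚ[G]) := hx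
  have hy' : f y = ((b ^ t : Subalgebra.center ℚ ℚ[G]) : ℚ[G]) := hy
  have hcomm (w : ℤ[G]) : w * x = x * w := by
    apply hf
    rw [map_mul, map_mul, hx']
    exact Subalgebra.mem_center_iff.1 (a ^ t).2 _
  have hxy : x * y = 1 := by
    apply hf
    rw [map_mul, hx', hy', map_one, ← Subalgebra.coe_mul, ← mul_pow, hab, one_pow]
    rfl
  let u : ℤ[G]ˣ := ⟨x, y, hxy, by rw [hcomm, hxy]⟩
  have hu : u ∈ Subgroup.center ℤ[G]ˣ :=
    Subgroup.mem_center_iff.2 fun v ↦ Units.ext (hcomm v)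
  obtain ⟨g, -, hg⟩ := hG u hu
  have hg2 : x ^ 2 = MonoidAlgebra.of ℤ G (g ^ 2) := by
    rw [map_pow]
    rcases hg with hg | hg
    · exact congrArg (· ^ 2) hg
    · exact (congrArg (· ^ 2) hg).trans (neg_sq _)
  refine ⟨t * (2 * Nat.card G), mul_ne_zero ht (mul_ne_zero two_ne_zero Nat.card_pos.ne'), ?_⟩
  apply Subtype.ext
  rw [pow_mul, Subalgebra.coe_pow, ← hx', ← map_pow, pow_mul, hg2, ← map_pow, pow_card_eq_one',
    map_one, map_one]
  rfl

/-- A reduced Artinian ring `A` splits off its residue field `K`, so that a unit of `𝓞 K` lifts to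
a unit of `A`, equal to `1` in the other factors; lift and inverse are again integral. -/
theorem exists_mul_eq_one_isIntegral_of_unit {A K : Type*} [CommRing A] [IsArtinianRing A]
    [IsReduced A] [Field K] (π : A →+* K) (hπ : Function.Surjective π)
    (u : (NumberField.RingOfIntegers K)ˣ) :
    ∃ a b : A, a * b = 1 ∧ IsIntegral ℤ a ∧ IsIntegral ℤ b ∧
      π a = (u : NumberField.RingOfIntegers K) := by
  classical
  have hmax : (RingHom.ker π).IsMaximal := RingHom.ker_isMaximal_of_surjective π hπ
  let M : MaximalSpectrum A := ⟨RingHom.ker π, hmax⟩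
  -- the idempotent of `A` that cuts out the factor `K`
  obtain ⟨ε, hε⟩ := (IsArtinianRing.equivPi A).surjective (Pi.single M 1)
  have hεM : π ε = 1 := by
    have := congrFun hε M
    rw [IsArtinianRing.equivPi_apply, Pi.single_eq_same, ← map_one (Ideal.Quotient.mk _)] at this
    have := (Ideal.Quotient.mk_eq_mk_iff_sub_mem _ _).1 this
    rw [RingHom.mem_ker] at this
    rwa [map_sub, map_one, sub_eq_zero] at this
  have hε0 (x : A) (hx : π x = 0) : ε * x = 0 := by
    apply (IsArtinianRing.equivPi A).injective
    rw [map_mul, hε, map_zero]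
    ext N
    by_cases hN : N = M
    · subst hN
      have hxN : IsArtinianRing.equivPi A x M = 0 :=
        Ideal.Quotient.eq_zero_iff_mem.2 (RingHom.mem_ker.2 hx)
      rw [Pi.mul_apply, hxN, Pi.zero_apply, mul_zero]
    · simp [hN]
  have hε2 : ε * (1 - ε) = 0 := hε0 _ (by rw [map_sub, hεM, map_one, sub_self])
  have hlift (v : NumberField.RingOfIntegers K) (x : A) (hx : π x = v) :
      IsIntegral ℤ (ε * x + (1 - ε)) := by
    obtain ⟨p, hp, hpv⟩ := v.isIntegral_coe
    -- the factor `X - 1` accounts for the other factors of `A`, where the element is `1`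
    refine ⟨p * (Polynomial.X - 1), hp.mul (Polynomial.monic_X_sub_C 1), ?_⟩
    rw [← Polynomial.aeval_def] at hpv ⊢
    set a := ε * x + (1 - ε)
    have h1 : ε * Polynomial.aeval a p = 0 := hε0 _ (by
      have : π a = v := by rw [map_add, map_mul, map_sub, hεM, map_one, sub_self, hx]; simp
      have h := Polynomial.aeval_algHom_apply π.toIntAlgHom a p
      exact h.symm.trans ((congrArg (Polynomial.aeval · p) this).trans hpv))
    rw [map_mul, map_sub, Polynomial.aeval_X, map_one]
    have h2 : a - 1 = ε * (x - 1) := by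
      change ε * x + (1 - ε) - 1 = _
      ring
    rw [h2, ← mul_assoc, mul_comm _ ε, h1, zero_mul]
  obtain ⟨x, hx⟩ := hπ (u : NumberField.RingOfIntegers K)
  obtain ⟨y, hy⟩ := hπ ((u⁻¹ : (NumberField.RingOfIntegers K)ˣ) : NumberField.RingOfIntegers K)
  have hxy : π (x * y - 1) = 0 := by
    rw [map_sub, map_mul, hx, hy, map_one, ← map_mul, ← Units.val_mul, mul_inv_cancel]
    simp
  exact ⟨ε * x + (1 - ε), ε * y + (1 - ε),
    by linear_combination ε * hε0 _ hxy + (x + y - 2) * hε2, hlift _ x hx, hlift _ y hy,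
    by rw [map_add, map_mul, map_sub, hεM, map_one, sub_self, hx, one_mul, add_zero]⟩

theorem HasCutProperty.isOfFinOrder_units {G K : Type*} [Group G] [Finite G]
    (hG : HasCutProperty G) [Field K] (π : Subalgebra.center ℚ ℚ[G] →+* K)
    (hπ : Function.Surjective π) (u : (NumberField.RingOfIntegers K)ˣ) : IsOfFinOrder u := by
  have : IsArtinianRing (Subalgebra.center ℚ ℚ[G]) := IsArtinianRing.of_finite ℚ _
  obtain ⟨a, b, hab, ha, hb, hau⟩ := exists_mul_eq_one_isIntegral_of_unit π hπ u
  obtain ⟨t, ht, hat⟩ := hG.exists_pow_eq_one hab ha hb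
  refine isOfFinOrder_iff_pow_eq_one.2 ⟨t, Nat.pos_of_ne_zero ht, ?_⟩
  have := congrArg π hat
  rw [map_pow, hau, map_one, ← map_pow] at this
  ext
  simpa using this

/-- By Dirichlet's unit theorem the unit rank is the number of infinite places minus one. -/
theorem NumberField.card_infinitePlace_le_one_of_isOfFinOrder {K : Type*} [Field K] [NumberField K]
    (h : ∀ u : (NumberField.RingOfIntegers K)ˣ, IsOfFinOrder u) :
    Fintype.card (NumberField.InfinitePlace K) ≤ 1 := by
  have hrank := NumberField.Units.finrank_eq K
  have htors : Module.IsTorsion ℤ (Additive (NumberField.RingOfIntegers K)ˣ) :=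
    isAddTorsion_iff_isTorsion_int.1 fun u ↦
      (isOfFinAddOrder_ofMul_iff (x := u.toMul)).2 (h u.toMul)
  rw [Module.finrank_eq_zero_iff_isTorsion.2 htors] at hrank
  exact Nat.sub_eq_zero_iff_le.1 hrank.symm

theorem NumberField.of_surjective {A K : Type*} [CommRing A] [Algebra ℚ A] [Module.Finite ℚ A]
    [Field K] [CharZero K] (π : A →+* K) (hπ : Function.Surjective π) : NumberField K where
  to_finiteDimensional := Module.Finite.of_surjective π.toRatAlgHom.toLinearMap hπ

/-- If `G` has the cut-property, the image of a homomorphism from the centre of `ℚ[G]` to a field is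
`ℚ` or an imaginary quadratic field: two complex embeddings agree on it up to conjugation. -/
theorem HasCutProperty.eq_or_eq_conj {G F : Type*} [Group G] [Finite G] [Field F] [CharZero F]
    (hG : HasCutProperty G) (φ : Subalgebra.center ℚ ℚ[G] →ₐ[ℚ] F) (σ τ : F →+* ℂ) :
    (∀ z, σ (φ z) = τ (φ z)) ∨ ∀ z, σ (φ z) = starRingEnd ℂ (τ (φ z)) := by
  let A := Subalgebra.center ℚ ℚ[G]
  have : IsArtinianRing A := IsArtinianRing.of_finite ℚ A
  let I : Ideal A := RingHom.ker (φ : A →+* F)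
  have : I.IsPrime := RingHom.ker_isPrime _
  have : I.IsMaximal := inferInstance
  let K := A ⧸ I
  let _ : Field K := Ideal.Quotient.field I
  let π : A →+* K := Ideal.Quotient.mk I
  have hπ : Function.Surjective π := Ideal.Quotient.mk_surjective
  let ψ : K →+* F := Ideal.Quotient.lift I (φ : A →+* F) fun _ h ↦ h
  have hψ (z : A) : ψ (π z) = φ z := rfl
  have : CharZero K := RingHom.charZero ψ
  have : NumberField K := .of_surjective π hπ
  have hcard := NumberField.card_infinitePlace_le_one_of_isOfFinOrder
    (hG.isOfFinOrder_units π hπ)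
  have := Fintype.card_le_one_iff_subsingleton.1 hcard
  have hpl : NumberField.InfinitePlace.mk (σ.comp ψ) = NumberField.InfinitePlace.mk (τ.comp ψ) :=
    Subsingleton.elim _ _
  rcases NumberField.InfinitePlace.mk_eq_iff.1 hpl.symm with h | h
  · exact .inl fun z ↦ (RingHom.congr_fun h (π z)).symm
  · exact .inr fun z ↦ (RingHom.congr_fun h (π z)).symm

/-! ### Central elements and class sums -/

theorem MonoidAlgebra.mem_center_iff_coeff {R G : Type*} [CommRing R] [Group G] {z : R[G]} :
    z ∈ Subalgebra.center R R[G] ↔ ∀ x y : G, z.coeff (x * y * x⁻¹) = z.coeff y := by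
  have hiff (x : G) : Commute (single x 1) z ↔ ∀ y : G, z.coeff (x * y * x⁻¹) = z.coeff y := by
    rw [commute_iff_eq, MonoidAlgebra.ext_iff, Finsupp.ext_iff]
    refine ⟨fun h y ↦ ?_, fun h y ↦ ?_⟩
    · have := h (x * y)
      rwa [coeff_mul_single_apply, coeff_single_mul_apply, inv_mul_cancel_left, one_mul, mul_one,
        eq_comm] at this
    · have := h (x⁻¹ * y)
      rwa [mul_inv_cancel_left, eq_comm, ← one_mul (z.coeff _), ← mul_one (z.coeff (y * x⁻¹)),
        ← coeff_mul_single_apply, ← coeff_single_mul_apply] at this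
  rw [Subalgebra.mem_center_iff]
  refine ⟨fun h x ↦ (hiff x).1 (h _), fun h w ↦ ?_⟩
  induction w using MonoidAlgebra.induction_linear with
  | zero => rw [zero_mul, mul_zero]
  | add a b ha hb => rw [add_mul, mul_add, ha, hb]
  | single g r =>
    have h2 : single g r = r • (single g 1 : R[G]) := by simp [smul_single]
    rw [h2, smul_mul_assoc, mul_smul_comm, ((hiff g).2 (h g)).eq]

open Classical in
/-- The sum of the conjugates of `g`, as an element of the centre of `ℚ[G]`. -/
noncomputable def classSum {G : Type*} [Group G] [Finite G] (g : G) : Subalgebra.center ℚ ℚ[G] :=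
  ⟨.ofCoeff (Finsupp.equivFunOnFinite.symm fun x ↦ if IsConj g x then 1 else 0), by
    rw [MonoidAlgebra.mem_center_iff_coeff]
    intro x y
    have h : IsConj y (x * y * x⁻¹) := isConj_iff.2 ⟨x, rfl⟩
    have : IsConj g (x * y * x⁻¹) ↔ IsConj g y := ⟨fun hg ↦ hg.trans h.symm, fun hg ↦ hg.trans h⟩
    exact if_congr this rfl rfl⟩

open Classical in
theorem coeff_classSum {G : Type*} [Group G] [Finite G] (g x : G) :
    (classSum g : ℚ[G]).coeff x = if IsConj g x then 1 else 0 := rfl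

theorem isConj_pow_iff_of_coprime {G : Type*} [Group G] {j : ℕ}
    (hj : (Nat.card G).Coprime j) {g x : G} : IsConj (g ^ j) (x ^ j) ↔ IsConj g x := by
  refine ⟨fun h ↦ ?_, fun h ↦ ?_⟩ <;> rw [isConj_iff] at h ⊢ <;> obtain ⟨a, ha⟩ := h <;>
    refine ⟨a, ?_⟩
  · rw [← conj_pow] at ha
    exact (powCoprime hj).injective ha
  · rw [← conj_pow, ha]

theorem IsCentralCharacter.map_classSum {G F L : Type*} [Group G] [Finite G] [Field F]
    [CharZero F] [IsAlgClosed F] [Field L] [CharZero L]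
    {φ : Subalgebra.center ℚ ℚ[G] →ₐ[ℚ] F} (hφ : IsCentralCharacter φ) (σ τ : F →+* L) {j : ℕ}
    (hj : (Nat.card G).Coprime j) (h : ∀ ζ : F, ζ ^ Nat.card G = 1 → σ ζ = τ (ζ ^ j)) (g : G) :
    σ (φ (classSum g)) = τ (φ (classSum (g ^ j))) := by
  have := Fintype.ofFinite G
  refine hφ.map_eq_map σ τ j h _ _ fun f _ ↦ ?_
  refine Fintype.sum_equiv (powCoprime hj) _ _ fun x ↦ ?_
  have := isConj_pow_iff_of_coprime hj (g := g) (x := x)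
  by_cases hx : IsConj g x <;> simp only [hx, iff_true, iff_false] at this <;>
    simp only [coeff_classSum, powCoprime_apply, hx, this, if_true, if_false]

/-! ### From the cut-property to conjugacy of powers -/

/-- If `G` has the cut-property, each generator of `⟨g⟩` is conjugate to `g` or to `g⁻¹`: the sums
of the class sums of `g ^ j` and its inverse, and of `g` and its inverse, agree under every central
character. -/
theorem HasCutProperty.isConj_pow_or {G : Type*} [Group G] [Finite G] (hG : HasCutProperty G)
    (g : G) {j : ℕ} (hj : j.Coprime (Nat.card G)) :
    IsConj (g ^ j) g ∨ IsConj (g ^ j) g⁻¹ := by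
  let F := AlgebraicClosure ℚ
  have : IsAlgClosure ℚ F := isAlgClosure_algebraicClosure_rat
  have hn : Nat.card G ≠ 0 := Nat.card_pos.ne'
  obtain ⟨σ, hσ⟩ := IsAlgClosure.exists_algEquiv_pow F hn hj
  let ι : F →+* ℂ := (IsAlgClosed.lift : F →ₐ[ℚ] ℂ)
  have hconj (ζ : F) (hζ : ζ ^ Nat.card G = 1) :
      (starRingEnd ℂ).comp ι ζ = ι (ζ ^ (Nat.card G - 1)) := by
    have h1 : ι ζ ^ Nat.card G = 1 := by rw [← map_pow, hζ, map_one]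
    rw [RingHom.comp_apply, ← Complex.inv_eq_conj (Complex.norm_eq_one_of_pow_eq_one h1 hn), map_pow]
    exact inv_eq_of_mul_eq_one_right (by rw [mul_pow_sub_one hn, h1])
  have hinv (x : G) : x ^ (Nat.card G - 1) = x⁻¹ :=
    (inv_eq_of_mul_eq_one_right (by rw [mul_pow_sub_one hn, pow_card_eq_one'])).symm
  have hcop : (Nat.card G).Coprime (Nat.card G - 1) := by
    rw [Nat.coprime_self_sub_right Nat.card_pos]
    exact Nat.coprime_one_right _
  -- on a given central character, `σ` acts either trivially or as complex conjugation, that is,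
  -- as `g ↦ g⁻¹`; the sum over `g` and `g⁻¹` is unchanged in both cases
  have hsum : classSum (g ^ j) + classSum (g⁻¹ ^ j) - (classSum g + classSum g⁻¹) = 0 := by
    refine eq_zero_of_forall_isCentralCharacter F fun φ hφ ↦ ?_
    have hσ' (x : G) := hφ.map_classSum (ι.comp (σ : F →+* F)) ι hj.symm
      (fun ζ hζ ↦ congrArg ι (hσ ζ hζ)) x
    have hc (x : G) := hφ.map_classSum ((starRingEnd ℂ).comp ι) ι hcop hconj x
    simp only [hinv] at hc
    have h1 := hσ' g
    have h2 := hσ' g⁻¹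
    have h3 := hc g
    have h4 := hc g⁻¹
    rw [inv_inv] at h4
    apply ι.injective
    simp only [map_sub, map_add, map_zero]
    rcases hG.eq_or_eq_conj φ (ι.comp (σ : F →+* F)) ι with h | h
    · rw [← h1, ← h2, h, h, sub_self]
    · rw [← h1, ← h2, h, h]
      rw [RingHom.comp_apply] at h3 h4
      rw [h3, h4, add_comm, sub_self]
  have hcoeff := congrArg (fun z : Subalgebra.center ℚ ℚ[G] ↦ (z : ℚ[G]).coeff (g ^ j)) hsum
  by_contra! hcon
  have hne1 : ¬ IsConj g (g ^ j) := fun h ↦ hcon.1 h.symm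
  have hne2 : ¬ IsConj g⁻¹ (g ^ j) := fun h ↦ hcon.2 h.symm
  simp only [Subalgebra.coe_sub, Subalgebra.coe_add, MonoidAlgebra.coeff_sub,
    MonoidAlgebra.coeff_add, Finsupp.sub_apply, Finsupp.add_apply, coeff_classSum,
    IsConj.refl, if_true, hne1, hne2, if_false, Subalgebra.coe_zero, MonoidAlgebra.coeff_zero,
    Finsupp.zero_apply] at hcoeff
  split_ifs at hcoeff <;> norm_num at hcoeff

/-- In a finite `3`-group with the cut-property, `g ^ j` is conjugate to `g` itself as soon as
`j ≡ 1` modulo `3`. -/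
theorem IsPGroup.isConj_pow_of_hasCutProperty {G : Type*} [Group G] [Finite G] (h3 : IsPGroup 3 G)
    (hG : HasCutProperty G) (g : G) {j : ℕ} (hj : j % 3 = 1) : IsConj (g ^ j) g := by
  have : Fact (Nat.Prime 3) := ⟨Nat.prime_three⟩
  obtain ⟨n, hn⟩ := IsPGroup.iff_card.1 h3
  have hcop {k : ℕ} (hk : k % 3 ≠ 0) : k.Coprime (Nat.card G) := by
    rw [hn]
    refine Nat.Coprime.pow_right _ ((Nat.coprime_comm.1 ?_))
    exact (Nat.prime_three.coprime_iff_not_dvd).2 fun h ↦ hk (Nat.mod_eq_zero_of_dvd h)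
  rcases hG.isConj_pow_or g (hcop (by omega : j % 3 ≠ 0)) with h | h
  · exact h
  -- Otherwise conjugation by some `a` maps `g ^ j` to `g⁻¹`; iterating it as often as the order of
  -- the group, an odd number, gives `g ^ (j ^ 3 ^ n) = g⁻¹`. Since `j ^ 3 ^ n + 1` is prime to `3`,
  -- this forces `g = 1`.
  obtain ⟨a, ha⟩ := isConj_iff.1 h
  have hiter (k : ℕ) : a ^ k * g ^ (j ^ k) * (a ^ k)⁻¹ = g ^ ((-1 : ℤ) ^ k) := by
    induction k with
    | zero => simp
    | succ k ih =>
      have : a ^ (k + 1) * g ^ (j ^ (k + 1)) * (a ^ (k + 1))⁻¹ =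
          a * (a ^ k * g ^ (j ^ k) * (a ^ k)⁻¹) ^ j * a⁻¹ := by
        rw [conj_pow, ← pow_mul, ← pow_succ, pow_succ' a]
        group
      rw [this, ih, ← zpow_natCast, zpow_comm, zpow_natCast, ← conj_zpow, ha, inv_zpow', pow_succ]
      simp
  have hk := hiter (3 ^ n)
  rw [← hn, pow_card_eq_one', one_mul, inv_one, mul_one, hn,
    Odd.neg_one_pow (Odd.pow (by decide)), zpow_neg_one] at hk
  have hg : g ^ (j ^ 3 ^ n + 1) = 1 := by rw [pow_succ, hk, inv_mul_cancel]
  have hg1 : g = 1 := by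
    have h1 : (Nat.card G).Coprime (j ^ 3 ^ n + 1) := (hcop (by
      rw [Nat.add_mod, Nat.pow_mod, hj]
      simp)).symm
    exact (powCoprime h1).injective (by simpa using hg)
  rw [hg1, one_pow]

/-! ### From conjugacy of powers to the cut-property -/

theorem isConj_pow_inv_of_forall_isConj_pow {G : Type*} [Group G] [Finite G]
    (h : ∀ (g : G) (j : ℕ), j % 3 = 1 → IsConj (g ^ j) g) (g : G) {j : ℕ} (hj : j % 3 = 2) :
    IsConj (g ^ j) g⁻¹ := by
  have hcard : 0 < Nat.card G := Nat.card_pos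
  -- the exponent is `-j` modulo the order of `G`, and `1` modulo `3`
  have hk := h g⁻¹ (j * (3 * Nat.card G - 1)) (by
    rw [Nat.mul_mod, hj, show (3 * Nat.card G - 1) % 3 = 2 by omega])
  have hpow : g⁻¹ ^ (j * (3 * Nat.card G - 1)) = g ^ j := by
    rw [inv_pow, inv_eq_iff_mul_eq_one, ← pow_add, ← Nat.mul_succ,
      show (3 * Nat.card G - 1).succ = Nat.card G * 3 by omega, mul_left_comm, pow_mul,
      pow_card_eq_one', one_pow]
  rwa [hpow] at hk

/-- Under the conjugacy condition, central characters are rational on symmetric central elements,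
being fixed there by the absolute Galois group. -/
theorem IsCentralCharacter.exists_rat_eq {G F : Type*} [Group G] [Finite G] [Field F] [CharZero F]
    [IsAlgClosure ℚ F] (h : ∀ (g : G) (j : ℕ), j % 3 = 1 → IsConj (g ^ j) g)
    {φ : Subalgebra.center ℚ ℚ[G] →ₐ[ℚ] F} (hφ : IsCentralCharacter φ)
    {z : Subalgebra.center ℚ ℚ[G]} (hz : ∀ g, (z : ℚ[G]).coeff g⁻¹ = (z : ℚ[G]).coeff g) :
    ∃ q : ℚ, algebraMap ℚ F q = φ z := by
  have := Fintype.ofFinite G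
  have : IsAlgClosed F := IsAlgClosure.isAlgClosed ℚ
  have : Algebra.IsAlgebraic ℚ F := IsAlgClosure.isAlgebraic
  have : Normal ℚ F := IsAlgClosure.normal ℚ F
  have : IsGalois ℚ F := {}
  refine (InfiniteGalois.mem_range_algebraMap_iff_fixed (φ z)).2 fun σ ↦ ?_
  -- the factor `3` forces `3 ∤ j` even if `3` does not divide the order of `G`
  obtain ⟨j, hj, hσ⟩ := IsAlgClosure.exists_pow_of_algEquiv
    (n := 3 * Nat.card G) (mul_ne_zero three_ne_zero Nat.card_pos.ne') σ
  have hσ' (ζ : F) (hζ : ζ ^ Nat.card G = 1) : (σ : F →+* F) ζ = RingHom.id F (ζ ^ j) :=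
    hσ ζ (by rw [mul_comm, pow_mul, hζ, one_pow])
  have hj3 : j % 3 = 1 ∨ j % 3 = 2 := by
    have : ¬ 3 ∣ j := fun hdvd ↦ by
      have := Nat.dvd_gcd hdvd (Dvd.intro (Nat.card G) rfl : 3 ∣ 3 * Nat.card G)
      rw [hj] at this
      omega
    omega
  have hclass (f : G → F) (hf : ∀ x y, f (x * y * x⁻¹) = f y) {x y : G} (hxy : IsConj x y) :
      f x = f y := by
    obtain ⟨c, rfl⟩ := isConj_iff.1 hxy
    exact (hf c x).symm
  refine hφ.map_eq_map (σ : F →+* F) (RingHom.id F) j hσ' z z fun f hf ↦ ?_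
  rcases hj3 with hj3 | hj3
  · exact Finset.sum_congr rfl fun g _ ↦ by rw [hclass f hf (h g j hj3)]
  · refine Fintype.sum_equiv (Equiv.inv G) _ _ fun g ↦ ?_
    rw [Equiv.inv_apply, hz, hclass f hf (isConj_pow_inv_of_forall_isConj_pow h g hj3)]

/-- Central characters send a symmetric central unit of `ℤ[G]` to a rational algebraic integer
with integral inverse, hence to `1` or `-1`. -/
theorem sq_eq_one_of_coeff_inv_eq {G : Type*} [Group G] [Finite G]
    (h : ∀ (g : G) (j : ℕ), j % 3 = 1 → IsConj (g ^ j) g) {v w : ℤ[G]}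
    (hv : v ∈ Subalgebra.center ℤ ℤ[G]) (hw : w ∈ Subalgebra.center ℤ ℤ[G]) (hvw : v * w = 1)
    (hv' : ∀ g, v.coeff g⁻¹ = v.coeff g) (hw' : ∀ g, w.coeff g⁻¹ = w.coeff g) : v ^ 2 = 1 := by
  let F := AlgebraicClosure ℚ
  have : IsAlgClosure ℚ F := isAlgClosure_algebraicClosure_rat
  let f := MonoidAlgebra.mapRingHom G (Int.castRingHom ℚ)
  have hf : Function.Injective f := MonoidAlgebra.mapRingHom_intCast_injective G
  have hfc (x : ℤ[G]) (hx : x ∈ Subalgebra.center ℤ ℤ[G]) : f x ∈ Subalgebra.center ℚ ℚ[G] := by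
    rw [MonoidAlgebra.mem_center_iff_coeff] at hx ⊢
    intro a b
    simp only [f, MonoidAlgebra.coeff_mapRingHom, hx]
  let V : Subalgebra.center ℚ ℚ[G] := ⟨f v, hfc v hv⟩
  let W : Subalgebra.center ℚ ℚ[G] := ⟨f w, hfc w hw⟩
  have hVW : V * W = 1 := Subtype.ext (by
    change f v * f w = 1
    rw [← map_mul, hvw, map_one])
  have hint (x : ℤ[G]) (hx : x ∈ Subalgebra.center ℤ ℤ[G]) :
      IsIntegral ℤ (⟨f x, hfc x hx⟩ : Subalgebra.center ℚ ℚ[G]) := by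
    have h1 : IsIntegral ℤ x := IsIntegral.of_finite ℤ x
    have h2 : IsIntegral ℤ (f x) := map_isIntegral_int f h1
    exact (isIntegral_algHom_iff ((Subalgebra.center ℚ ℚ[G]).val.restrictScalars ℤ)
      Subtype.val_injective).1 h2
  have key (x : ℤ[G]) (hx : x ∈ Subalgebra.center ℤ ℤ[G]) (hx' : ∀ g, x.coeff g⁻¹ = x.coeff g)
      (φ : Subalgebra.center ℚ ℚ[G] →ₐ[ℚ] F) (hφ : IsCentralCharacter φ) :
      ∃ k : ℤ, (k : F) = φ ⟨f x, hfc x hx⟩ := by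
    obtain ⟨q, hq⟩ := hφ.exists_rat_eq h (z := ⟨f x, hfc x hx⟩) (by
      intro g
      simp only [f, MonoidAlgebra.coeff_mapRingHom, hx'])
    have h1 : IsIntegral ℤ (φ ⟨f x, hfc x hx⟩) := map_isIntegral_int φ (hint x hx)
    rw [← hq] at h1
    have h2 : IsIntegral ℤ q := (isIntegral_algHom_iff
      ((Algebra.ofId ℚ F).restrictScalars ℤ) (algebraMap ℚ F).injective).1 h1
    obtain ⟨k, hk⟩ := IsIntegrallyClosed.isIntegral_iff.1 h2
    exact ⟨k, by rw [← hq, ← hk]; simp⟩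
  have hV2 : V ^ 2 - 1 = 0 := by
    refine eq_zero_of_forall_isCentralCharacter F fun φ hφ ↦ ?_
    obtain ⟨k, hk⟩ := key v hv hv' φ hφ
    obtain ⟨l, hl⟩ := key w hw hw' φ hφ
    have hkl : (k : F) * l = 1 := by
      rw [hk, hl, ← map_mul]
      exact (congrArg φ hVW).trans (map_one φ)
    have hkl' : k * l = 1 := Int.cast_injective (α := F) (by rw [Int.cast_mul, hkl, Int.cast_one])
    have hk2 : k ^ 2 = 1 := by
      rcases Int.isUnit_iff.1 (IsUnit.of_mul_eq_one _ hkl') with rfl | rfl <;> norm_num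
    have : φ V = k := hk.symm
    rw [map_sub, map_pow, map_one, this, ← Int.cast_pow, hk2, Int.cast_one, sub_self]
  have hV2' : f v ^ 2 = 1 := congrArg Subtype.val (sub_eq_zero.1 hV2)
  apply hf
  rw [map_pow, hV2', map_one]

/-- The canonical involution `x ↦ x^*` of the group ring, which inverts group elements. It reverses
products, so it is encoded as a homomorphism to the opposite ring. -/
noncomputable def MonoidAlgebra.invOp (R G : Type*) [CommRing R] [Group G] :
    R[G] →ₐ[R] R[G]ᵐᵒᵖ :=
  MonoidAlgebra.lift R R[G]ᵐᵒᵖ G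
    { toFun g := MulOpposite.op (MonoidAlgebra.of R G g⁻¹)
      map_one' := by simp only [inv_one, map_one, MulOpposite.op_one]
      map_mul' x y := by simp only [mul_inv_rev, map_mul, MulOpposite.op_mul] }

theorem MonoidAlgebra.coeff_unop_invOp {R G : Type*} [CommRing R] [Group G] (x : R[G]) (g : G) :
    (invOp R G x).unop.coeff g = x.coeff g⁻¹ := by
  classical
  induction x using MonoidAlgebra.induction_linear with
  | zero => simp
  | add x y hx hy => simp [hx, hy]
  | single h r =>
    simp [invOp, Finsupp.single_apply, inv_eq_iff_eq_inv]

theorem MonoidAlgebra.unop_invOp_mem_center {R G : Type*} [CommRing R] [Group G] {x : R[G]}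
    (hx : x ∈ Subalgebra.center R R[G]) : (invOp R G x).unop ∈ Subalgebra.center R R[G] := by
  rw [mem_center_iff_coeff] at hx ⊢
  intro a b
  rw [coeff_unop_invOp, coeff_unop_invOp, conj_inv, hx]

theorem MonoidAlgebra.coeff_one_mul_unop_invOp {R G : Type*} [CommRing R] [Group G] [Fintype G]
    (x : R[G]) : (x * (invOp R G x).unop).coeff 1 = ∑ g, x.coeff g ^ 2 := by
  rw [coeff_mul_apply_left, Finsupp.sum_fintype _ _ (by simp)]
  refine Finset.sum_congr rfl fun g _ ↦ ?_
  rw [coeff_unop_invOp, mul_one, inv_inv, sq]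

theorem MonoidAlgebra.coeff_inv_mul_unop_invOp {R G : Type*} [CommRing R] [Group G] (x : R[G])
    (g : G) : (x * (invOp R G x).unop).coeff g⁻¹ = (x * (invOp R G x).unop).coeff g := by
  have h : (invOp R G (invOp R G x).unop).unop = x := by
    ext a
    rw [coeff_unop_invOp, coeff_unop_invOp, inv_inv]
  rw [← coeff_unop_invOp, map_mul, MulOpposite.unop_mul, h]

theorem MonoidAlgebra.eq_of_or_eq_neg_of_of_sum_sq_eq_one {G : Type*} [Group G] [Fintype G]
    {x : ℤ[G]} (hx : ∑ g, x.coeff g ^ 2 = 1) :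
    ∃ g, x = of ℤ G g ∨ x = -of ℤ G g := by
  classical
  obtain ⟨g, -, hg⟩ : ∃ g ∈ Finset.univ, x.coeff g ^ 2 ≠ 0 :=
    Finset.exists_ne_zero_of_sum_ne_zero (by rw [hx]; exact one_ne_zero)
  have hsplit := Finset.add_sum_erase Finset.univ (fun g ↦ x.coeff g ^ 2) (Finset.mem_univ g)
  have hrest : 0 ≤ ∑ a ∈ Finset.univ.erase g, x.coeff a ^ 2 :=
    Finset.sum_nonneg fun a _ ↦ sq_nonneg _
  have hpos : 0 < x.coeff g ^ 2 := lt_of_le_of_ne (sq_nonneg _) hg.symm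
  have hone : x.coeff g ^ 2 = 1 := by omega
  have hzero : ∑ a ∈ Finset.univ.erase g, x.coeff a ^ 2 = 0 := by omega
  have hz (a : G) (ha : a ≠ g) : x.coeff a = 0 :=
    pow_eq_zero_iff two_ne_zero |>.1 ((Finset.sum_eq_zero_iff_of_nonneg
      fun a _ ↦ sq_nonneg _).1 hzero a (Finset.mem_erase.2 ⟨ha, Finset.mem_univ a⟩))
  refine ⟨g, ?_⟩
  rcases sq_eq_one_iff.1 hone with hg1 | hg1
  · left
    ext a
    by_cases ha : a = g
    · simp [ha, hg1]
    · simp [hz a ha, Ne.symm ha]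
  · right
    ext a
    by_cases ha : a = g
    · simp [ha, hg1]
    · simp [hz a ha, Ne.symm ha]

/-- The converse: apply `sq_eq_one_of_coeff_inv_eq` to `v = u * u^*`, where `u^*` is the image of
`u` under inversion of group elements. Since `v = v^*` and `v ^ 2 = 1`, the squared coefficients of
`v` sum to `1`, while the coefficient of `v` at `1` is the positive integer `∑ g, u g ^ 2`. Hence
this integer is `1`, and `u` has a single nonzero coefficient, equal to `1` or `-1`. -/
theorem hasCutProperty_of_forall_isConj_pow {G : Type*} [Group G] [Finite G]
    (h : ∀ (g : G) (j : ℕ), j % 3 = 1 → IsConj (g ^ j) g) : HasCutProperty G := by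
  have := Fintype.ofFinite G
  classical
  intro u hu
  have hcenter (w : ℤ[G]ˣ) (hw : w ∈ Subgroup.center ℤ[G]ˣ) :
      (w : ℤ[G]) ∈ Subalgebra.center ℤ ℤ[G] := by
    rw [Subalgebra.mem_center_iff]
    intro y
    induction y using MonoidAlgebra.induction_linear with
    | zero => rw [zero_mul, mul_zero]
    | add a b ha hb => rw [add_mul, mul_add, ha, hb]
    | single g r =>
      have h1 := congrArg Units.val (Subgroup.mem_center_iff.1 hw
        (Units.map (MonoidAlgebra.of ℤ G) (toUnits g)))
      have h2 : MonoidAlgebra.single g r = r • (MonoidAlgebra.of ℤ G g) := by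
        simp [MonoidAlgebra.smul_single]
      rw [h2, smul_mul_assoc, mul_smul_comm]
      exact congrArg (r • ·) h1
  let s := MonoidAlgebra.invOp ℤ G
  have huc := hcenter u hu
  have huc' := hcenter u⁻¹ (inv_mem hu)
  have hs : (s u).unop * (s (u⁻¹ : ℤ[G]ˣ)).unop = 1 := by
    rw [← MulOpposite.unop_mul, ← map_mul, Units.inv_mul, map_one, MulOpposite.unop_one]
  have hvw : (u * (s u).unop : ℤ[G]) * ((u⁻¹ : ℤ[G]ˣ) * (s (u⁻¹ : ℤ[G]ˣ)).unop) = 1 := by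
    rw [mul_assoc, ← mul_assoc _ ((u⁻¹ : ℤ[G]ˣ) : ℤ[G]), Subalgebra.mem_center_iff.1 huc',
      mul_assoc, hs, mul_one, Units.mul_inv]
  have hv2 := sq_eq_one_of_coeff_inv_eq h
    (mul_mem huc (MonoidAlgebra.unop_invOp_mem_center huc))
    (mul_mem huc' (MonoidAlgebra.unop_invOp_mem_center huc')) hvw
    (MonoidAlgebra.coeff_inv_mul_unop_invOp _) (MonoidAlgebra.coeff_inv_mul_unop_invOp _)
  set v : ℤ[G] := u * (s u).unop with hv
  have hsv : (s v).unop = v := by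
    ext g
    rw [MonoidAlgebra.coeff_unop_invOp, MonoidAlgebra.coeff_inv_mul_unop_invOp]
  have hsum : ∑ g, v.coeff g ^ 2 = 1 := by
    rw [← MonoidAlgebra.coeff_one_mul_unop_invOp]
    change (v * (s v).unop).coeff 1 = 1
    rw [hsv, ← sq, hv2, MonoidAlgebra.coeff_one_one]
  have hv1 : v.coeff 1 = ∑ g, (u : ℤ[G]).coeff g ^ 2 := MonoidAlgebra.coeff_one_mul_unop_invOp _
  have hle : v.coeff 1 ^ 2 ≤ 1 := by
    rw [← hsum]
    exact Finset.single_le_sum (f := fun g ↦ v.coeff g ^ 2) (fun a _ ↦ sq_nonneg _)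
      (Finset.mem_univ 1)
  have hne : v.coeff 1 ≠ 0 := by
    intro h0
    rw [hv1, Finset.sum_eq_zero_iff_of_nonneg fun a _ ↦ sq_nonneg _] at h0
    apply u.ne_zero
    ext a
    simpa using h0 a (Finset.mem_univ a)
  have hnonneg : 0 ≤ v.coeff 1 := by
    rw [hv1]
    exact Finset.sum_nonneg fun a _ ↦ sq_nonneg _
  have hu1 : ∑ g, (u : ℤ[G]).coeff g ^ 2 = 1 := by
    rw [← hv1]
    nlinarith [lt_of_le_of_ne hnonneg hne.symm]
  obtain ⟨g, hg⟩ := MonoidAlgebra.eq_of_or_eq_neg_of_of_sum_sq_eq_one hu1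
  refine ⟨g, Subgroup.mem_center_iff.2 fun x ↦ ?_, hg⟩
  apply MonoidAlgebra.of_injective (R := ℤ)
  have hx := Subalgebra.mem_center_iff.1 huc (MonoidAlgebra.of ℤ G x)
  rw [map_mul, map_mul]
  rcases hg with hg | hg
  · rwa [hg] at hx
  · rwa [hg, mul_neg, neg_mul, neg_inj] at hx

/-! ### Direct products -/

theorem corollary2p3 {H : Type*} {K : Type*} [Group H] [Group K] [Finite H] [Finite K]
    (hH3 : IsPGroup 3 H) (hK3 : IsPGroup 3 K)
    (hH : HasCutProperty H) (hK : HasCutProperty K) :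
    HasCutProperty (H × K) := by
  refine hasCutProperty_of_forall_isConj_pow fun g j hj ↦ ?_
  obtain ⟨a, ha⟩ := isConj_iff.1 (hH3.isConj_pow_of_hasCutProperty hH g.1 hj)
  obtain ⟨b, hb⟩ := isConj_iff.1 (hK3.isConj_pow_of_hasCutProperty hK g.2 hj)
  exact isConj_iff.2 ⟨(a, b), Prod.ext ha hb⟩
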